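/- Let $G$ be a finitely generated free group, and let $\Omega$ be the Cantor space. Let $\Xi(G)=\mathrm{Hom}(G,\mathrm{Homeo}(\Omega))$ be the space of actions of $G$ on $\Omega$ by homeomorphisms, with the topology inherited from $\mathrm{Homeo}(\Omega)^G$, where $\mathrm{Homeo}(\Omega)$ carries the topology of uniform convergence. Let $\Xi_{\mathrm{mnpmp}}(G)\subseteq\Xi(G)$ be the subspace of the actions that are minimal and admit an invariant Borel probability measure. The conjugacy class of $\xi\in\Xi(G)$ is $\{f\xi f^{-1} : f\in\mathrm{Homeo}(\Omega)\}$, where $(f\xi f^{-1})(g)=f\,\xi(g)\,f^{-1}$. For a finite discrete set $A$, let $G$ act on the product space $A^G$ by $(g\cdot x)(h)=x(g^{-1}h)$, and call the non-empty closed $G$-invariant subsets of $A^G$ subshifts; the space of subshifts carries the Vietoris topology. Then: 1. If $G$ is non-trivial, there is a conjugacy class contained in $\Xi_{\mathrm{mnpmp}}(G)$ that is comeager in $\Xi_{\mathrm{mnpmp}}(G)$, and every element of it is isomorphic (by a $G$-equivariant homeomorphism) to the action of $G$ by left translation on its profinite completion. 2. For every finite set $A$, the finite topologically transitive subshifts of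 $A^G$ form a dense subset of the space of all minimal subshifts of $A^G$ that admit an invariant Borel probability measure. -/

import Mathlib

open Set Topology

universe u v w

namespace CantorFlow

section Flows

variable {G : Type u} [Group G] {Z : Type v} [TopologicalSpace Z] {W : Type w} [TopologicalSpace W]

/-- An action `φ` of `G` on `Z` by homeomorphisms is minimal if every non-empty open set is
syndetic, that is, finitely many of its translates cover `Z`. -/
def IsMinimal (φ : G →* (Z ≃ₜ Z)) : Prop :=
  ∀ U : Set Z, IsOpen U → U.Nonempty → ∃ F : Finset G, (⋃ g ∈ F, φ g '' U) = univ

/-- An action `φ` of `G` on `Z` by homeomorphisms is (topologically) transitive if any non-empty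
open set meets a translate of any other one. -/
def IsTransitive (φ : G →* (Z ≃ₜ Z)) : Prop :=
  ∀ U V : Set Z, IsOpen U → U.Nonempty → IsOpen V → V.Nonempty → ∃ g : G, (φ g '' U ∩ V).Nonempty

/-- The action `φ` admits an invariant Borel probability measure. -/
def HasInvariantMeasure (φ : G →* (Z ≃ₜ Z)) : Prop :=
  letI : MeasurableSpace Z := borel Z
  ∃ μ : MeasureTheory.Measure Z, MeasureTheory.IsProbabilityMeasure μ ∧
    ∀ (g : G) (a : Set Z), MeasurableSet a → μ (φ g '' a) = μ a

/-- Two actions of `G` are isomorphic if there is a `G`-equivariant homeomorphism between them. -/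
def Isomorphic (φ : G →* (Z ≃ₜ Z)) (ψ : G →* (W ≃ₜ W)) : Prop :=
  ∃ f : Z ≃ₜ W, ∀ (g : G) (z : Z), f (φ g z) = ψ g (f z)

/-- The space of subflows of `φ`: the non-empty compact `G`-invariant subsets, with the
(subspace of the) Vietoris topology, which Mathlib puts on `NonemptyCompacts Z`. -/
abbrev Subflow (φ : G →* (Z ≃ₜ Z)) : Type v :=
  {X : TopologicalSpace.NonemptyCompacts Z // ∀ (g : G) (x : Z), x ∈ X → φ g x ∈ X}

theorem Subflow.mem_iff {φ : G →* (Z ≃ₜ Z)} (X : Subflow φ) (g : G) (x : Z) :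
    x ∈ X.1 ↔ φ g x ∈ X.1 := by
  refine ⟨X.2 g x, fun h => ?_⟩
  have h' := X.2 g⁻¹ _ h
  rwa [← Homeomorph.mul_apply, ← map_mul, inv_mul_cancel, map_one, Homeomorph.one_apply] at h'

/-- The action of `G` on a subflow. -/
def Subflow.action {φ : G →* (Z ≃ₜ Z)} (X : Subflow φ) :
    G →* ({x : Z // x ∈ X.1} ≃ₜ {x : Z // x ∈ X.1}) where
  toFun g := (φ g).subtype (X.mem_iff g)
  map_one' := by ext x; simp
  map_mul' g h := by ext x; simp

end Flows

/-- The Cantor space. -/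
abbrev Cantor : Type := ℕ → Bool

/-- The space of actions of `G` on the Cantor space by homeomorphisms. -/
abbrev ActionSpace (G : Type u) [Group G] : Type u := G →* (Cantor ≃ₜ Cantor)

/-- The topology inherited from the product `Homeo(Ω)^G`, where `Homeo(Ω)` carries the topology of
uniform convergence, i.e. (`Ω` being compact) the compact-open topology of `C(Ω, Ω)`. -/
instance (G : Type u) [Group G] : TopologicalSpace (ActionSpace G) :=
  TopologicalSpace.induced
    (fun (ξ : ActionSpace G) (g : G) => (ξ g : C(Cantor, Cantor)))
    inferInstance

/-- The conjugacy class of an action `ξ`: all the actions `g ↦ f ξ(g) f⁻¹`, where `f` is a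
homeomorphism of the Cantor space. -/
def conjClass {G : Type u} [Group G] (ξ : ActionSpace G) : Set (ActionSpace G) :=
  {η | ∃ f : Cantor ≃ₜ Cantor, ∀ g : G, η g = f * ξ g * f⁻¹}

/-- The set of minimal actions on the Cantor space that admit an invariant probability measure. -/
def minPmpActions (G : Type u) [Group G] : Set (ActionSpace G) :=
  {ξ | IsMinimal ξ ∧ HasInvariantMeasure ξ}

/-- The action of `G` by left translation on its profinite completion, the inverse limit of the
finite quotients of `G`. -/
def profiniteTranslation (G : Type u) [Group G] :
    G →* (ProfiniteGrp.ProfiniteCompletion.completion (GrpCat.of G) ≃ₜ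
      ProfiniteGrp.ProfiniteCompletion.completion (GrpCat.of G)) where
  toFun g := Homeomorph.mulLeft ((ProfiniteGrp.ProfiniteCompletion.eta (GrpCat.of G)).hom g)
  map_one' := by
    ext x
    rw [map_one]
    simp
  map_mul' g h := by
    ext x
    rw [map_mul]
    simp [mul_assoc]

section Subshifts

variable (G : Type u) [Group G] (A : Type v) [TopologicalSpace A]

/-- The left shift `(g • x) h = x (g⁻¹ h)` on `A ^ G`. -/
def shift : G →* ((G → A) ≃ₜ (G → A)) where
  toFun g :=
    { toFun := fun x h => x (g⁻¹ * h)
      invFun := fun x h => x (g * h)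
      left_inv := fun x => by simp
      right_inv := fun x => by simp
      continuous_toFun := by fun_prop
      continuous_invFun := by fun_prop }
  map_one' := by ext x h; simp
  map_mul' g g' := by ext x h; simp [mul_assoc]

/-- The minimal subshifts of `A ^ G` that admit an invariant probability measure. -/
def minPmpSubshifts : Set (Subflow (shift G A)) :=
  {X | IsMinimal X.action ∧ HasInvariantMeasure X.action}

/-- The periodic (that is, finite) transitive subshifts of `A ^ G`. -/
def periodicTransitiveSubshifts : Set (Subflow (shift G A)) :=
  {X | (X.1 : Set (G → A)).Finite ∧ IsTransitive X.action}

end Subshifts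

end CantorFlow

open CantorFlow

/-! Everything rests on finite models. Label the points of an action with an invariant measure by a
finite clopen partition. The measures of the cells, and of the transitions between cells along each
generator, satisfy linear relations with integer coefficients: transitions out of a cell, and by
invariance those into it, add up to the cell. A `ℚ`-linear map `ℝ → ℚ` that is positive on the
positive weights, followed by clearing denominators, gives a solution in natural numbers with the
same support. Taking that many points over each cell, every generator can be realised by a
permutation, and freeness makes any choice of permutations an action of `G`. If the labels are
patterns over a ball, all patterns of the model occur in the action; minimality makes all patterns
of the action occur along one orbit of the model (`exists_finite_model_of_isMinimal`).

For subshifts, the itineraries of that orbit form a finite transitive subshift with the prescribed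
patterns, whence density.

For Cantor actions, that orbit is a factor of the profinite completion, which is a Cantor space by
Brouwer's theorem. The translation can therefore be conjugated to agree with the given action on
finitely many group elements and coordinates (`exists_isomorphic_agree`), so its isomorphism class
is dense. The class is also a relative `G_δ`: having all finite quotients as factors, and having
points separated by them, is a countable intersection of open conditions that characterises the
translation (`isomorphic_profiniteTranslation`). -/

namespace CantorFlow

open scoped Pointwise

/-! ### Integer weights and permutations with prescribed transitions -/

/-- A `ℚ`-linear functional on `ℝ` can be chosen to be positive at finitely many positive reals. -/
theorem exists_ratLinear_pos {ι : Type*} [Finite ι] (w : ι → ℝ) :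
    ∃ f : ℝ →ₗ[ℚ] ℚ, ∀ i, 0 < w i → 0 < f (w i) := by
  classical
  let V : Submodule ℚ ℝ := Submodule.span ℚ (range w)
  have : FiniteDimensional ℚ V := FiniteDimensional.span_of_finite ℚ (finite_range w)
  let b := Module.finBasis ℚ V
  let v : ι → V := fun i => ⟨w i, Submodule.subset_span (mem_range_self i)⟩
  have hsum : ∀ i, w i = ∑ j, (b.repr (v i) j : ℝ) * (b j : ℝ) := by
    intro i
    have h := congrArg (Subtype.val : V → ℝ) (b.sum_repr (v i))
    rw [Submodule.coe_sum] at h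
    simpa [Rat.smul_def, v] using h.symm
  -- Positivity is an open condition on the values given to the basis. The inclusion `V → ℝ`
  -- satisfies it, and rational values are dense.
  let O : Set (Fin (Module.finrank ℚ V) → ℝ) :=
    {r | ∀ i, 0 < w i → 0 < ∑ j, (b.repr (v i) j : ℝ) * r j}
  have hO : IsOpen O := by
    have : O = ⋂ i, ⋂ _ : 0 < w i, {r | 0 < ∑ j, (b.repr (v i) j : ℝ) * r j} := by
      ext r; simp [O]
    rw [this]
    refine isOpen_iInter_of_finite fun i => isOpen_iInter_of_finite fun _ => ?_
    exact isOpen_lt continuous_const (by fun_prop)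
  have hd : DenseRange (Pi.map fun (_ : Fin (Module.finrank ℚ V)) (q : ℚ) => (q : ℝ)) :=
    DenseRange.piMap fun _ => Rat.denseRange_cast
  obtain ⟨q, hq⟩ := hd.exists_mem_open hO ⟨fun j => (b j : ℝ), fun i hi => hsum i ▸ hi⟩
  obtain ⟨f, hf⟩ := LinearMap.exists_extend (b.constr ℚ q : V →ₗ[ℚ] ℚ)
  refine ⟨f, fun i hi => ?_⟩
  have h1 : f (w i) = ∑ j, b.repr (v i) j * q j := by
    have : f (w i) = (b.constr ℚ q : V →ₗ[ℚ] ℚ) (v i) := by rw [← hf]; rfl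
    rw [this, Module.Basis.constr_apply_fintype]
    simp [Module.Basis.equivFun_apply]
  have h2 := hq i hi
  rw [h1]
  simp only [Pi.map_apply] at h2
  exact_mod_cast h2

/-- Finitely many nonnegative reals can be replaced by natural numbers that satisfy the same
`ℚ`-linear relations and vanish only where the reals do. -/
theorem exists_natCast_weights {ι : Type*} [Finite ι] (w : ι → ℝ) (hw : ∀ i, 0 ≤ w i) :
    ∃ (f : ℝ →ₗ[ℚ] ℚ) (n : ι → ℕ), ∀ i, f (w i) = n i ∧ (0 < w i → 0 < n i) := by
  classical
  have := Fintype.ofFinite ι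
  obtain ⟨f, hf⟩ := exists_ratLinear_pos w
  let D : ℕ := ∏ i, (f (w i)).den
  have hD : 0 < D := Finset.prod_pos fun i _ => (f (w i)).den_pos
  have h0 : ∀ i, 0 ≤ f (w i) := fun i => by
    rcases (hw i).eq_or_lt with h | h
    · simp [← h]
    · exact (hf i h).le
  have hex : ∀ i, ∃ m : ℕ, (D : ℚ) * f (w i) = m := by
    intro i
    obtain ⟨k, hk⟩ : (f (w i)).den ∣ D := Finset.dvd_prod_of_mem _ (Finset.mem_univ i)
    refine ⟨k * (f (w i)).num.toNat, ?_⟩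
    have h1 : (((f (w i)).num.toNat : ℤ) : ℚ) = (f (w i)).num := by
      rw [Int.toNat_of_nonneg (Rat.num_nonneg.2 (h0 i))]
    have h2 : f (w i) * (f (w i)).den = (f (w i)).num := Rat.mul_den_eq_num _
    rw [hk]
    push_cast at h1 ⊢
    rw [h1, ← h2]
    ring
  choose n hn using hex
  refine ⟨(D : ℚ) • f, n, fun i => ⟨by simpa using hn i, fun hi => ?_⟩⟩
  have : (0 : ℚ) < n i := by
    rw [← hn i]
    exact mul_pos (by exact_mod_cast hD) (hf i hi)
  exact_mod_cast this

/-- A permutation of a finite labelled set with prescribed numbers of transitions. -/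
theorem exists_perm_of_transitions {P : Type*} [Fintype P] (n : P → ℕ) (N : P → P → ℕ)
    (hrow : ∀ p, ∑ q, N p q = n p) (hcol : ∀ q, ∑ p, N p q = n q) :
    ∃ σ : Equiv.Perm (Σ p, Fin (n p)), ∀ y, 0 < N y.1 (σ y).1 := by
  -- The points over a label are sorted twice by transitions, as sources by the next label and as
  -- targets by the previous one; matching the two sortings gives the permutation.
  have e1 : ∀ p, Fin (n p) ≃ Σ q, Fin (N p q) := fun p =>
    Fintype.equivOfCardEq (by simp [hrow])
  have e2 : ∀ q, (Σ p, Fin (N p q)) ≃ Fin (n q) := fun q =>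
    Fintype.equivOfCardEq (by simp [hcol])
  let s : (Σ p, Σ q, Fin (N p q)) ≃ Σ q, Σ p, Fin (N p q) :=
    { toFun := fun x => ⟨x.2.1, x.1, x.2.2⟩
      invFun := fun x => ⟨x.2.1, x.1, x.2.2⟩
      left_inv := fun _ => rfl
      right_inv := fun _ => rfl }
  refine ⟨((Equiv.sigmaCongrRight e1).trans s).trans (Equiv.sigmaCongrRight e2), fun y => ?_⟩
  exact Nat.zero_lt_of_lt (e1 y.1 y.2).2.isLt

open MeasureTheory in
theorem sum_measureReal_inter_preimage {X P : Type*} [MeasurableSpace X] (μ : Measure X)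
    [IsFiniteMeasure μ] [Fintype P] (q : X → P) (hq : ∀ b, MeasurableSet (q ⁻¹' {b}))
    {s : Set X} (hs : MeasurableSet s) : ∑ b, μ.real (s ∩ q ⁻¹' {b}) = μ.real s := by
  rw [← measureReal_iUnion_fintype (fun a b hab => ?_) (fun b => hs.inter (hq b))]
  · rw [← inter_iUnion, ← preimage_iUnion, iUnion_of_singleton, preimage_univ, inter_univ]
  · refine Disjoint.mono inter_subset_right inter_subset_right ?_
    exact Disjoint.preimage _ (by simpa using hab)

/-- A finitely generated group has finitely many homomorphisms to a finite group. -/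
theorem finite_monoidHom (G H : Type*) [Group G] [Group.FG G] [Group H] [Finite H] :
    Finite (G →* H) := by
  obtain ⟨S, hS, hfin⟩ := (Group.fg_iff (G := G)).1 inferInstance
  have : Finite S := hfin
  refine Finite.of_injective (fun (f : G →* H) (s : S) => f s) fun f f' h => ?_
  exact MonoidHom.eq_of_eqOn_top (hS ▸ MonoidHom.eqOn_closure fun s hs => congrFun h ⟨s, hs⟩)

/-- Maps from a basis to a two-element group are homomorphisms from `G`, of which there are finitely
many; an infinite basis would give infinitely many. -/
theorem finite_generators (G : Type u) [Group G] [IsFreeGroup G] [Group.FG G] :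
    Finite (IsFreeGroup.Generators G) := by
  let H := Multiplicative (ZMod 2)
  have h1 : Finite (G →* H) := finite_monoidHom G H
  have h2 : Finite (IsFreeGroup.Generators G → H) := Finite.of_equiv _ IsFreeGroup.lift.symm
  by_contra h
  rw [not_finite_iff_infinite] at h
  exact not_finite (IsFreeGroup.Generators G → H)

theorem closure_range_of (G : Type u) [Group G] [IsFreeGroup G] :
    Subgroup.closure (range (IsFreeGroup.of : IsFreeGroup.Generators G → G)) = ⊤ := by
  have h := congrArg (Subgroup.map (IsFreeGroup.mulEquiv G).toMonoidHom)
    (FreeGroup.closure_range_of (IsFreeGroup.Generators G))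
  rw [MonoidHom.map_closure, ← range_comp, Subgroup.map_top_of_surjective _
    (IsFreeGroup.mulEquiv G).surjective] at h
  exact h

/-- A finite subset of a finitely generated group is contained in a ball. -/
theorem exists_subset_pow {G : Type u} [Group G] {S : Set G} (hS : Subgroup.closure S = ⊤)
    (F : Finset G) : ∃ n : ℕ, (F : Set G) ⊆ ({1} ∪ S ∪ S⁻¹) ^ n := by
  classical
  set E : Set G := {1} ∪ S ∪ S⁻¹ with hE
  have h1 : (1 : G) ∈ E := by simp [hE]
  have key : ∀ g : G, ∃ n : ℕ, g ∈ E ^ n := by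
    intro g
    have hg : g ∈ Subgroup.closure S := hS ▸ Subgroup.mem_top g
    induction hg using Subgroup.closure_induction_right with
    | one => exact ⟨0, by simp⟩
    | mul_right x hx y hy ih =>
      obtain ⟨n, hn⟩ := ih
      exact ⟨n + 1, by rw [pow_succ]; exact Set.mul_mem_mul hn (by simp [hE, hy])⟩
    | mul_inv_cancel x hx y hy ih =>
      obtain ⟨n, hn⟩ := ih
      exact ⟨n + 1, by rw [pow_succ]; exact Set.mul_mem_mul hn (by simp [hE, hy])⟩
  choose n hn using key
  exact ⟨F.sup n, fun g hg => Set.pow_subset_pow_right h1 (Finset.le_sup hg) (hn g)⟩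

/-! ### Finite models of measure-preserving actions -/

section

variable {G : Type u} [Group G] [IsFreeGroup G] [Group.FG G] {X : Type v} [TopologicalSpace X]
  {P : Type w} [Finite P] [TopologicalSpace P] [DiscreteTopology P]

/-- A labelled action of a free group with an invariant measure has a finite model with the same
transitions between labels along the generators. -/
theorem exists_finite_transition_model {φ : G →* (X ≃ₜ X)} (hφ : HasInvariantMeasure φ)
    {p : X → P} (hp : Continuous p) :
    ∃ (Y : Type) (_ : Finite Y) (_ : Nonempty Y) (ρ : G →* Equiv.Perm Y) (l : Y → P),
      (∀ y, l y ∈ range p) ∧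
      ∀ (t : IsFreeGroup.Generators G) (y : Y), ∃ x : X, l y = p x ∧
        l (ρ (IsFreeGroup.of t) y) = p (φ (IsFreeGroup.of t) x) := by
  classical
  have := finite_generators G
  have := Fintype.ofFinite P
  let : MeasurableSpace X := borel X
  have : BorelSpace X := ⟨rfl⟩
  obtain ⟨μ, hμ, hinv⟩ := hφ
  let T := IsFreeGroup.Generators G
  let α : T → X → X := fun t => φ (IsFreeGroup.of t)
  have hpm : ∀ a, MeasurableSet (p ⁻¹' {a}) := fun a =>
    ((isOpen_discrete {a}).preimage hp).measurableSet
  have hα : ∀ t, Measurable (α t) := fun t => (φ (IsFreeGroup.of t)).continuous.measurable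
  have hpα : ∀ t b, MeasurableSet (α t ⁻¹' (p ⁻¹' {b})) := fun t b => hα t (hpm b)
  have hμα : ∀ t b, μ.real (α t ⁻¹' (p ⁻¹' {b})) = μ.real (p ⁻¹' {b}) := by
    intro t b
    have h := hinv (IsFreeGroup.of t) _ (hpα t b)
    rw [image_preimage_eq _ (φ (IsFreeGroup.of t)).surjective] at h
    simp only [MeasureTheory.Measure.real, h]
  -- Cells and transitions are weighted together, so that one linear functional respects all
  -- relations between them.
  let wt : P ⊕ (T × P × P) → ℝ := Sum.elim (fun a => μ.real (p ⁻¹' {a}))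
    fun x => μ.real (p ⁻¹' {x.2.1} ∩ α x.1 ⁻¹' (p ⁻¹' {x.2.2}))
  obtain ⟨f, n, hn⟩ := exists_natCast_weights wt (by
    rintro (a | x) <;> exact MeasureTheory.measureReal_nonneg)
  have hrow : ∀ t a, ∑ b, n (Sum.inr (t, a, b)) = n (Sum.inl a) := by
    intro t a
    have h : ∑ b, wt (Sum.inr (t, a, b)) = wt (Sum.inl a) :=
      sum_measureReal_inter_preimage μ (p ∘ α t) (hpα t) (hpm a)
    have h' := congrArg f h
    rw [map_sum, (hn _).1, Finset.sum_congr rfl fun b _ => (hn (Sum.inr (t, a, b))).1] at h'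
    exact_mod_cast h'
  have hcol : ∀ t b, ∑ a, n (Sum.inr (t, a, b)) = n (Sum.inl b) := by
    intro t b
    have h : ∑ a, wt (Sum.inr (t, a, b)) = wt (Sum.inl b) := by
      have h0 := sum_measureReal_inter_preimage μ p hpm (hpα t b)
      rw [hμα] at h0
      simpa only [wt, Sum.elim_inr, Sum.elim_inl, inter_comm] using h0
    have h' := congrArg f h
    rw [map_sum, (hn _).1, Finset.sum_congr rfl fun a _ => (hn (Sum.inr (t, a, b))).1] at h'
    exact_mod_cast h'
  choose σ hσ using fun t =>
    exists_perm_of_transitions (fun a => n (Sum.inl a)) (fun a b => n (Sum.inr (t, a, b)))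
      (hrow t) (hcol t)
  have hne : Nonempty (Σ a, Fin (n (Sum.inl a))) := by
    have h1 : ∑ a, μ.real (p ⁻¹' {a}) = 1 := by
      simpa using sum_measureReal_inter_preimage μ p hpm MeasurableSet.univ
    obtain ⟨a, -, ha⟩ := Finset.exists_ne_zero_of_sum_ne_zero (h1.trans_ne one_ne_zero)
    have h2 : 0 < wt (Sum.inl a) :=
      lt_of_le_of_ne MeasureTheory.measureReal_nonneg (Ne.symm ha)
    exact ⟨⟨a, 0, (hn _).2 h2⟩⟩
  -- Moving to `Fin` puts the model in `Type`, whatever the universe of `P`.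
  let e := Finite.equivFin (Σ a, Fin (n (Sum.inl a)))
  refine ⟨_, inferInstance, e.symm.nonempty, e.permCongrHom.toMonoidHom.comp (IsFreeGroup.lift σ),
    fun y => (e.symm y).1, fun y => ?_, fun t y => ?_⟩
  -- By linearity `f` sends zero to zero, so a label used in the model has positive measure and
  -- occurs.
  · have h1 : (0 : ℚ) < f (wt (Sum.inl (e.symm y).1)) := by
      rw [(hn _).1]
      exact_mod_cast Nat.zero_lt_of_lt (e.symm y).2.isLt
    have h2 : μ.real (p ⁻¹' {(e.symm y).1}) ≠ 0 := fun h =>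
      h1.ne' (by rw [show wt (Sum.inl (e.symm y).1) = 0 from h, map_zero])
    exact MeasureTheory.nonempty_of_measureReal_ne_zero h2
  obtain ⟨y, rfl⟩ := e.surjective y
  simp only [MonoidHom.comp_apply, MulEquiv.toMonoidHom_eq_coe, MonoidHom.coe_coe,
    Equiv.permCongrHom_coe, Equiv.permCongr_apply, Equiv.symm_apply_apply, IsFreeGroup.lift_of]
  have h1 : (0 : ℚ) < f (wt (Sum.inr (t, y.1, (σ t y).1))) := by
    rw [(hn _).1]
    exact_mod_cast hσ t y
  have h2 : μ.real (p ⁻¹' {y.1} ∩ α t ⁻¹' (p ⁻¹' {(σ t y).1})) ≠ 0 := fun h =>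
    h1.ne' (by rw [show wt (Sum.inr (t, y.1, (σ t y).1)) = 0 from h, map_zero])
  obtain ⟨x, hx1, hx2⟩ := MeasureTheory.nonempty_of_measureReal_ne_zero h2
  exact ⟨x, hx1.symm, hx2.symm⟩

/-- Finite models of an action of a free group with an invariant measure: every pattern of the model
on a given finite set is a pattern of the action. -/
theorem exists_finite_model {φ : G →* (X ≃ₜ X)} (hφ : HasInvariantMeasure φ)
    {c : X → P} (hc : Continuous c) (F : Finset G) :
    ∃ (Y : Type) (_ : Finite Y) (_ : Nonempty Y) (ρ : G →* Equiv.Perm Y) (l : Y → P),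
      ∀ y, ∃ x, ∀ g ∈ F, l (ρ g y) = c (φ g x) := by
  classical
  have := finite_generators G
  obtain ⟨n, hn⟩ := exists_subset_pow (closure_range_of G) F
  set S : Set G := range (IsFreeGroup.of : IsFreeGroup.Generators G → G)
  set E : Set G := {1} ∪ S ∪ S⁻¹ with hE
  have hEfin : E.Finite := ((finite_singleton 1).union (finite_range _)).union (finite_range _).inv
  have h1E : (1 : G) ∈ E := by simp [hE]
  have hmono : ∀ {k m : ℕ}, k ≤ m → E ^ k ⊆ E ^ m := fun h => Set.pow_subset_pow_right h1E h
  have hpow : ∀ k : ℕ, (E ^ k).Finite := fun k => by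
    induction k with
    | zero => simp
    | succ k ih => rw [pow_succ]; exact ih.mul hEfin
  have : Finite ↥(E ^ n) := hpow n
  -- A label is now the whole pattern seen over the ball `E ^ n`. Transitions along generators force
  -- overlapping patterns to agree.
  obtain ⟨Y, hY, hYne, ρ, l, hr, hl⟩ := exists_finite_transition_model hφ
    (p := fun (x : X) (g : ↥(E ^ n)) => c (φ g x))
    (continuous_pi fun g => hc.comp (φ g).continuous)
  have h1n : (1 : G) ∈ E ^ n := Set.one_mem_pow h1E
  -- The `g`-entry of a pattern is the central entry at `ρ g y`: peel off the last letter of `g` and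
  -- move to the neighbouring point.
  have key : ∀ k ≤ n, ∀ g ∈ E ^ k, ∀ (hg : g ∈ E ^ n) (y : Y),
      l y ⟨g, hg⟩ = l (ρ g y) ⟨1, h1n⟩ := by
    intro k
    induction k with
    | zero =>
      intro _ g hg hg' y
      obtain rfl : g = 1 := by simpa using hg
      simp
    | succ k ih =>
      intro hk g hg hgn y
      rw [pow_succ] at hg
      obtain ⟨h, hh, s, hs, rfl⟩ := Set.mem_mul.1 hg
      have hhn : h ∈ E ^ n := hmono (by omega) hh
      have step : l y ⟨h * s, hgn⟩ = l (ρ s y) ⟨h, hhn⟩ := by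
        rcases hs with (rfl | ⟨t, rfl⟩) | ⟨t, ht⟩
        · simp
        · obtain ⟨x, hx1, hx2⟩ := hl t y
          rw [hx1, hx2]
          simp only [map_mul, Homeomorph.mul_apply]
        · obtain ⟨x, hx1, hx2⟩ := hl t (ρ s y)
          rw [ht, ← Equiv.Perm.mul_apply, ← map_mul, inv_mul_cancel, map_one,
            Equiv.Perm.one_apply] at hx2
          rw [hx1, hx2]
          simp only [← Homeomorph.mul_apply, ← map_mul,
            mul_inv_cancel_right]
      rw [step, ih (by omega) h hh hhn, map_mul, Equiv.Perm.mul_apply]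
  refine ⟨Y, hY, hYne, ρ, fun y => l y ⟨1, h1n⟩, fun y => ?_⟩
  obtain ⟨x, hx⟩ := hr y
  refine ⟨x, fun g hg => ?_⟩
  have h := key n le_rfl g (hn hg) (hn hg) y
  rw [← hx] at h
  exact h.symm

/-- In a minimal action, every pattern recurs along every orbit within bounded time. -/
theorem IsMinimal.exists_recurrence {G : Type u} [Group G] {X : Type v} [TopologicalSpace X]
    {P : Type w} [Finite P] [TopologicalSpace P] [DiscreteTopology P] {φ : G →* (X ≃ₜ X)}
    (hφ : IsMinimal φ) {c : X → P} (hc : Continuous c) (F : Finset G) :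
    ∃ F' : Finset G, ∀ x x' : X, ∃ g ∈ F', ∀ h ∈ F, c (φ h (φ g x)) = c (φ h x') := by
  classical
  let p : X → F → P := fun x h => c (φ h x)
  have hp : Continuous p := continuous_pi fun g => hc.comp (φ g).continuous
  have key : ∀ a : F → P, ∃ E : Finset G, a ∈ range p → ∀ x, ∃ g ∈ E, p (φ g x) = a := by
    intro a
    by_cases ha : a ∈ range p
    · obtain ⟨E, hE⟩ := hφ (p ⁻¹' {a}) ((isOpen_discrete {a}).preimage hp) ha
      refine ⟨E⁻¹, fun _ x => ?_⟩
      have hx : x ∈ ⋃ g ∈ E, φ g '' (p ⁻¹' {a}) := hE ▸ mem_univ x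
      simp only [mem_iUnion, exists_prop] at hx
      obtain ⟨g, hg, z, hz, rfl⟩ := hx
      refine ⟨g⁻¹, Finset.inv_mem_inv hg, ?_⟩
      rw [← Homeomorph.mul_apply, ← map_mul]
      simpa using hz
    · exact ⟨∅, fun h => absurd h ha⟩
  choose E hE using key
  have := Fintype.ofFinite (F → P)
  refine ⟨Finset.univ.biUnion E, fun x x' => ?_⟩
  obtain ⟨g, hg, h⟩ := hE (p x') ⟨x', rfl⟩ x
  exact ⟨g, Finset.mem_biUnion.2 ⟨_, Finset.mem_univ _, hg⟩, fun k hk => congrFun h ⟨k, hk⟩⟩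

/-- Finite models of a minimal action of a free group with an invariant measure: the patterns of the
model on a given finite set are exactly the patterns of the action. -/
theorem exists_finite_model_of_isMinimal {φ : G →* (X ≃ₜ X)} (hmin : IsMinimal φ)
    (hφ : HasInvariantMeasure φ) {c : X → P} (hc : Continuous c) (F : Finset G) :
    ∃ (Y : Type) (_ : Finite Y) (ρ : G →* Equiv.Perm Y) (l : Y → P) (y₀ : Y),
      (∀ y, ∃ x, ∀ g ∈ F, l (ρ g y) = c (φ g x)) ∧
      ∀ x, ∃ h, ∀ g ∈ F, l (ρ g (ρ h y₀)) = c (φ g x) := by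
  classical
  obtain ⟨E, hE⟩ := hmin.exists_recurrence hc F
  -- The window `F * E` lets the pattern at `y₀` contain the `F`-patterns at all its translates by
  -- `E`; by recurrence these exhaust the patterns of the action.
  obtain ⟨Y, hY, ⟨y₀⟩, ρ, l, hl⟩ := exists_finite_model hφ hc (F ∪ F * E)
  refine ⟨Y, hY, ρ, l, y₀, fun y => ?_, fun x => ?_⟩
  · obtain ⟨x, hx⟩ := hl y
    exact ⟨x, fun g hg => hx g (Finset.mem_union_left _ hg)⟩
  · obtain ⟨x₀, hx₀⟩ := hl y₀
    obtain ⟨h, hh, hx⟩ := hE x₀ x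
    refine ⟨h, fun g hg => ?_⟩
    rw [← Equiv.Perm.mul_apply, ← map_mul,
      hx₀ _ (Finset.mem_union_right _ (Finset.mul_mem_mul hg hh)), map_mul, Homeomorph.mul_apply,
      hx g hg]

end

open Filter

/-! ### Density of periodic subshifts -/

/-- An open neighbourhood of a compact subset of a product of discrete spaces is determined by
finitely many coordinates near that subset. -/
theorem exists_finset_agree {ι A : Type*} [TopologicalSpace A] [DiscreteTopology A]
    {K U : Set (ι → A)} (hK : IsCompact K) (hU : IsOpen U) (h : K ⊆ U) :
    ∃ F : Finset ι, ∀ x ∈ K, ∀ z : ι → A, (∀ i ∈ F, z i = x i) → z ∈ U := by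
  classical
  refine hK.induction_on (p := fun s => ∃ F : Finset ι, ∀ x ∈ s, ∀ z : ι → A,
    (∀ i ∈ F, z i = x i) → z ∈ U) ⟨∅, by simp⟩ ?_ ?_ ?_
  · rintro s t hst ⟨F, hF⟩
    exact ⟨F, fun x hx => hF x (hst hx)⟩
  · rintro s t ⟨F, hF⟩ ⟨F', hF'⟩
    refine ⟨F ∪ F', fun x hx z hz => ?_⟩
    rcases hx with hx | hx
    · exact hF x hx z fun i hi => hz i (Finset.mem_union_left _ hi)
    · exact hF' x hx z fun i hi => hz i (Finset.mem_union_right _ hi)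
  · intro x hx
    obtain ⟨I, u, hu, hsub⟩ := isOpen_pi_iff.1 hU x (h hx)
    refine ⟨(I : Set ι).pi fun i => {x i}, mem_nhdsWithin_of_mem_nhds ?_, I, fun y hy z hz => ?_⟩
    · exact set_pi_mem_nhds I.finite_toSet fun i _ => by simp
    · refine hsub fun i hi => ?_
      rw [hz i hi, hy i hi]
      exact (hu i hi).2

/-- A transitive action on a finite discrete space is minimal and preserves the uniform measure. -/
theorem IsTransitive.isMinimal_and_hasInvariantMeasure {G : Type u} [Group G] {Z : Type v}
    [TopologicalSpace Z] [Finite Z] [Nonempty Z] [DiscreteTopology Z] {φ : G →* (Z ≃ₜ Z)}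
    (hφ : IsTransitive φ) : IsMinimal φ ∧ HasInvariantMeasure φ := by
  classical
  have := Fintype.ofFinite Z
  constructor
  · rintro U - ⟨z, hz⟩
    have h : ∀ w, ∃ g, φ g z = w := fun w => by
      obtain ⟨g, x, ⟨y, rfl, rfl⟩, hw⟩ := hφ {z} {w} (isOpen_discrete _) (singleton_nonempty _)
        (isOpen_discrete _) (singleton_nonempty _)
      exact ⟨g, hw⟩
    choose g hg using h
    refine ⟨Finset.univ.image g, eq_univ_of_forall fun w => ?_⟩
    simp only [mem_iUnion, Finset.mem_image, Finset.mem_univ, true_and, exists_prop]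
    exact ⟨g w, ⟨w, rfl⟩, z, hz, hg w⟩
  · let _ : MeasurableSpace Z := borel Z
    have : BorelSpace Z := ⟨rfl⟩
    have h0 : MeasureTheory.Measure.count (univ : Set Z) ≠ 0 := by
      simp
    have h1 : MeasureTheory.Measure.count (univ : Set Z) ≠ ⊤ :=
      MeasureTheory.measure_ne_top _ _
    refine ⟨(MeasureTheory.Measure.count (univ : Set Z))⁻¹ • MeasureTheory.Measure.count,
      ⟨by simpa using ENNReal.inv_mul_cancel h0 h1⟩, fun g a _ => ?_⟩
    rw [MeasureTheory.Measure.smul_apply, MeasureTheory.Measure.smul_apply,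
      MeasureTheory.Measure.count_injective_image (φ g).injective]

section

variable {G : Type u} [Group G] {A : Type v} {Y : Type w}

/-- The configuration that records the labels met by the orbit of a point. -/
def itinerary (ρ : G →* Equiv.Perm Y) (l : Y → A) (y : Y) : G → A := fun g => l (ρ g⁻¹ y)

/-- The inverse in `itinerary` is what makes it equivariant for the left shift. -/
theorem shift_itinerary [TopologicalSpace A] (ρ : G →* Equiv.Perm Y) (l : Y → A) (g : G) (y : Y) :
    shift G A g (itinerary ρ l y) = itinerary ρ l (ρ g y) := by
  funext h
  change l (ρ (g⁻¹ * h)⁻¹ y) = l (ρ h⁻¹ (ρ g y))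
  rw [mul_inv_rev, inv_inv, map_mul, Equiv.Perm.mul_apply]

/-- The orbit of an itinerary in a finite labelled action, as a subshift. -/
def itinerarySubflow [TopologicalSpace A] [Finite Y] (ρ : G →* Equiv.Perm Y) (l : Y → A) (y : Y) :
    Subflow (shift G A) :=
  ⟨⟨⟨range fun g => itinerary ρ l (ρ g y),
      ((finite_range (itinerary ρ l)).subset
        (range_subset_iff.2 fun _ => mem_range_self _)).isCompact⟩, range_nonempty _⟩, by
    rintro g _ ⟨h, rfl⟩
    refine ⟨g * h, ?_⟩
    simp only [shift_itinerary, map_mul, Equiv.Perm.mul_apply]⟩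

theorem itinerarySubflow_mem_periodicTransitiveSubshifts [TopologicalSpace A] [Finite Y]
    (ρ : G →* Equiv.Perm Y) (l : Y → A) (y : Y) :
    itinerarySubflow ρ l y ∈ periodicTransitiveSubshifts G A := by
  refine ⟨(finite_range (itinerary ρ l)).subset (range_subset_iff.2 fun _ => mem_range_self _), ?_⟩
  rintro U V - ⟨⟨_, g, rfl⟩, hU⟩ - ⟨⟨_, h, rfl⟩, hV⟩
  refine ⟨h * g⁻¹, _, ⟨_, hU, rfl⟩, ?_⟩
  convert hV using 1
  refine Subtype.ext ?_
  change shift G A (h * g⁻¹) (itinerary ρ l (ρ g y)) = itinerary ρ l (ρ h y)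
  rw [shift_itinerary, ← Equiv.Perm.mul_apply, ← map_mul, inv_mul_cancel_right]

theorem periodicTransitiveSubshifts_subset (G : Type u) [Group G] (A : Type v)
    [TopologicalSpace A] [DiscreteTopology A] :
    periodicTransitiveSubshifts G A ⊆ minPmpSubshifts G A := by
  rintro X ⟨hfin, htr⟩
  have : Finite {x // x ∈ X.1} := hfin
  have : Nonempty {x // x ∈ X.1} := X.1.nonempty.to_subtype
  exact htr.isMinimal_and_hasInvariantMeasure

attribute [local instance] TopologicalSpace.vietoris in
-- The Vietoris topology is generated by these two kinds of sets, and convergence need only be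
-- tested on generators.
theorem tendsto_subflow_iff {Z : Type v} [TopologicalSpace Z] {φ : G →* (Z ≃ₜ Z)} {ι : Type*}
    {f : Filter ι} {K : ι → Subflow φ} {X : Subflow φ} :
    Tendsto K f (𝓝 X) ↔
      (∀ U : Set Z, IsOpen U → (X.1 : Set Z) ⊆ U → ∀ᶠ i in f, ((K i).1 : Set Z) ⊆ U) ∧
      ∀ U : Set Z, IsOpen U → ((X.1 : Set Z) ∩ U).Nonempty →
        ∀ᶠ i in f, (((K i).1 : Set Z) ∩ U).Nonempty := by
  have hi : IsInducing (fun K : Subflow φ => (K.1 : Set Z)) :=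
    (TopologicalSpace.NonemptyCompacts.isEmbedding_coe (α := Z)).isInducing.comp
      IsInducing.subtypeVal
  rw [hi.tendsto_nhds_iff, TopologicalSpace.tendsto_nhds_generateFrom_iff]
  simp only [mem_union, or_imp, forall_and, forall_mem_image]
  rfl

theorem minPmpSubshifts_subset_closure (G : Type u) [Group G] [IsFreeGroup G] [Group.FG G]
    (A : Type v) [Finite A] [TopologicalSpace A] [DiscreteTopology A] :
    minPmpSubshifts G A ⊆ closure (periodicTransitiveSubshifts G A) := by
  classical
  rintro X ⟨hmin, hinv⟩
  have key : ∀ F : Finset G, ∃ K ∈ periodicTransitiveSubshifts G A,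
      (∀ z ∈ K.1, ∃ x ∈ X.1, ∀ g ∈ F, z g = x g) ∧
      ∀ x ∈ X.1, ∃ z ∈ K.1, ∀ g ∈ F, z g = x g := by
    intro F
    -- The label is the entry at `1`. Since `x g` is the entry at `1` of `g⁻¹ • x`, the window has
    -- to be inverted.
    obtain ⟨Y, hY, ρ, l, y₀, h1, h2⟩ := exists_finite_model_of_isMinimal hmin hinv
      (c := fun x : {x // x ∈ X.1} => x.1 1) ((continuous_apply 1).comp continuous_subtype_val)
      (F.image (·⁻¹))
    have hact : ∀ (g : G) (x : {x // x ∈ X.1}), (X.action g⁻¹ x).1 1 = x.1 g := fun g x => by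
      change x.1 (g⁻¹⁻¹ * 1) = x.1 g
      simp
    refine ⟨itinerarySubflow ρ l y₀, itinerarySubflow_mem_periodicTransitiveSubshifts ρ l y₀,
      ?_, fun x hx => ?_⟩
    · rintro _ ⟨h, rfl⟩
      obtain ⟨x, hx⟩ := h1 (ρ h y₀)
      exact ⟨x.1, x.2, fun g hg => (hx g⁻¹ (Finset.mem_image_of_mem _ hg)).trans (hact g x)⟩
    · obtain ⟨h, hh⟩ := h2 ⟨x, hx⟩
      exact ⟨_, ⟨h, rfl⟩, fun g hg =>
        (hh g⁻¹ (Finset.mem_image_of_mem _ hg)).trans (hact g ⟨x, hx⟩)⟩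
  choose K hK hKX hXK using key
  refine mem_closure_of_tendsto (f := K) (b := atTop) (tendsto_subflow_iff.2 ⟨?_, ?_⟩)
    (Eventually.of_forall hK)
  · intro U hU hXU
    obtain ⟨F, hF⟩ := exists_finset_agree X.1.isCompact hU hXU
    filter_upwards [eventually_ge_atTop F] with E hE z hz
    obtain ⟨x, hx, hzx⟩ := hKX E z hz
    exact hF x hx z fun i hi => hzx i (hE hi)
  · rintro U hU ⟨x, hx, hxU⟩
    obtain ⟨F, hF⟩ := exists_finset_agree isCompact_singleton hU (singleton_subset_iff.2 hxU)
    filter_upwards [eventually_ge_atTop F] with E hE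
    obtain ⟨z, hz, hzx⟩ := hXK E x hx
    exact ⟨z, hz, hF x rfl z fun i hi => hzx i (hE hi)⟩

end

/-! ### Brouwer's characterisation of the Cantor space -/

section Brouwer

variable {X : Type u}

/-- The cells of the binary tree of sets obtained by successively cutting with the sets `s k D`. -/
def splitCell (s : ℕ → Set X → Set X) (b : ℕ → Bool) : ℕ → Set X
  | 0 => univ
  | k + 1 => {x ∈ splitCell s b k | x ∈ s k (splitCell s b k) ↔ b k = true}

/-- The cell of level `k` that contains the point `x`. -/
def pointCell (s : ℕ → Set X → Set X) (x : X) : ℕ → Set X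
  | 0 => univ
  | k + 1 => {y ∈ pointCell s x k | y ∈ s k (pointCell s x k) ↔ x ∈ s k (pointCell s x k)}

open Classical in
/-- The branch of the binary tree of cells that leads to the point `x`. -/
noncomputable def splitCode (s : ℕ → Set X → Set X) (x : X) (k : ℕ) : Bool :=
  decide (x ∈ s k (pointCell s x k))

theorem mem_pointCell (s : ℕ → Set X → Set X) (x : X) (k : ℕ) : x ∈ pointCell s x k := by
  induction k with
  | zero => trivial
  | succ k ih => exact ⟨ih, Iff.rfl⟩

theorem splitCell_splitCode (s : ℕ → Set X → Set X) (x : X) (k : ℕ) :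
    splitCell s (splitCode s x) k = pointCell s x k := by
  induction k with
  | zero => rfl
  | succ k ih => simp [splitCell, pointCell, ih, splitCode]

theorem pointCell_eq_of_mem {s : ℕ → Set X → Set X} {x y : X} {k : ℕ} (h : y ∈ pointCell s x k) :
    pointCell s y k = pointCell s x k := by
  induction k with
  | zero => rfl
  | succ k ih =>
    simp only [pointCell]
    rw [ih h.1]
    have := h.2
    simp only [this]

theorem splitCode_eq {s : ℕ → Set X → Set X} {x : X} {b : ℕ → Bool}
    (h : ∀ k, x ∈ splitCell s b k) : splitCode s x = b := by
  have key : ∀ k, pointCell s x k = splitCell s b k := by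
    intro k
    induction k with
    | zero => rfl
    | succ k ih =>
      have h1 := (h (k + 1)).2
      simp only [splitCell, pointCell, ih, h1]
  funext k
  have h1 := (h (k + 1)).2
  rw [← key] at h1
  simp only [splitCode, h1]
  simp

/-- **Brouwer's theorem**: a non-empty compact perfect space with a countable family of clopen sets
that separates its points is homeomorphic to the Cantor space. -/
theorem nonempty_homeomorph_cantor [TopologicalSpace X] [CompactSpace X] [PerfectSpace X]
    [Nonempty X] {ι : Type*} [Countable ι] (U' : ι → Set X) (hU' : ∀ i, IsClopen (U' i))
    (hsep' : ∀ x y, x ≠ y → ∃ i, x ∈ U' i ∧ y ∉ U' i) : Nonempty (X ≃ₜ Cantor) := by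
  classical
  have : Nonempty ι := by
    obtain ⟨x⟩ := ‹Nonempty X›
    obtain ⟨y, -, h⟩ := preperfect_iff_nhds.1 (PerfectSpace.univ_preperfect (α := X)) x
      (mem_univ x) univ Filter.univ_mem
    exact ⟨(hsep' y x h).choose⟩
  obtain ⟨j, hj⟩ := exists_surjective_nat ι
  let U : ℕ → Set X := fun n => U' (j n)
  have hU : ∀ n, IsClopen (U n) := fun n => hU' (j n)
  have hsep : ∀ x y, x ≠ y → ∃ n, x ∈ U n ∧ y ∉ U n := fun x y hxy => by
    obtain ⟨i, hi⟩ := hsep' x y hxy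
    obtain ⟨n, rfl⟩ := hj i
    exact ⟨n, hi⟩
  -- The cut of `D` at level `k` is `U k` if this splits `D` properly. Otherwise any proper cut will
  -- do, and perfectness provides a second point to cut off. Thus both halves are non-empty, and `U
  -- k` is constant on the cells of level `k + 1`.
  have hex : ∀ (k : ℕ) (D : Set X), ∃ E : Set X, IsClopen D → D.Nonempty →
      IsClopen E ∧ (D ∩ E).Nonempty ∧ (D \ E).Nonempty ∧ (D ⊆ U k ∨ D ∩ U k = ∅ ∨ E = U k) := by
    intro k D
    by_cases hD : IsClopen D ∧ D.Nonempty
    swap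
    · exact ⟨∅, fun h h' => absurd ⟨h, h'⟩ hD⟩
    obtain ⟨hD, x, hx⟩ := hD
    by_cases h1 : (D ∩ U k).Nonempty
    swap
    all_goals by_cases h2 : (D \ U k).Nonempty
    all_goals try exact ⟨U k, fun _ _ => ⟨hU k, h1, h2, Or.inr (Or.inr rfl)⟩⟩
    all_goals
      obtain ⟨y, hy, hyx⟩ : ∃ y ∈ D, y ≠ x := by
        have := preperfect_iff_nhds.1 (PerfectSpace.univ_preperfect (α := X)) x (mem_univ x) D
          (hD.isOpen.mem_nhds hx)
        obtain ⟨y, hy, h⟩ := this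
        exact ⟨y, hy.1, h⟩
      obtain ⟨n, hn, hn'⟩ := hsep y x hyx
      refine ⟨U n, fun _ _ => ⟨hU n, ⟨y, hy, hn⟩, ⟨x, hx, hn'⟩, ?_⟩⟩
    · exact Or.inr (Or.inl (not_nonempty_iff_eq_empty.1 h1))
    · exact Or.inr (Or.inl (not_nonempty_iff_eq_empty.1 h1))
    · exact Or.inl (sdiff_eq_empty.1 (not_nonempty_iff_eq_empty.1 h2))
  choose s hs using hex
  have hcell : ∀ b k, IsClopen (splitCell s b k) ∧ (splitCell s b k).Nonempty := by
    intro b k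
    induction k with
    | zero => exact ⟨isClopen_univ, univ_nonempty⟩
    | succ k ih =>
      obtain ⟨h1, h2, h3, -⟩ := hs k _ ih.1 ih.2
      cases hb : b k with
      | false =>
        have : splitCell s b (k + 1) = splitCell s b k \ s k (splitCell s b k) := by
          ext x; simp [splitCell, hb]
        rw [this]
        exact ⟨ih.1.diff h1, h3⟩
      | true =>
        have : splitCell s b (k + 1) = splitCell s b k ∩ s k (splitCell s b k) := by
          ext x; simp [splitCell, hb]
        rw [this]
        exact ⟨ih.1.inter h1, h2⟩
  have hcont : Continuous (splitCode s) := by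
    refine continuous_pi fun k => (IsLocallyConstant.iff_exists_open _).2 (fun x => ?_)
      |>.continuous
    refine ⟨pointCell s x (k + 1), ?_, mem_pointCell s x _, fun y hy => ?_⟩
    · rw [← splitCell_splitCode]
      exact (hcell _ _).1.isOpen
    · have h := hy.2
      simp only [splitCode]
      rw [pointCell_eq_of_mem hy.1]
      simp only [h]
  have hinj : Function.Injective (splitCode s) := by
    intro x y hxy
    by_contra hne
    obtain ⟨k, hxk, hyk⟩ := hsep x y hne
    have hx := mem_pointCell s x (k + 1)
    have hy := mem_pointCell s y (k + 1)
    rw [← splitCell_splitCode] at hx hy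
    rw [← hxy] at hy
    obtain ⟨-, -, -, h | h | h⟩ := hs k _ (hcell (splitCode s x) k).1 (hcell (splitCode s x) k).2
    · exact hyk (h hy.1)
    · exact (h ▸ (⟨hx.1, hxk⟩ : x ∈ _ ∩ U k) : x ∈ (∅ : Set X))
    · have h1 := hx.2
      have h2 := hy.2
      rw [h] at h1 h2
      exact hyk (h2.2 (h1.1 hxk))
  have hsurj : Function.Surjective (splitCode s) := by
    intro b
    obtain ⟨x, hx⟩ := IsCompact.nonempty_iInter_of_sequence_nonempty_isCompact_isClosed
      (splitCell s b) (fun k x hx => hx.1) (fun k => (hcell b k).2)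
      (hcell b 0).1.isClosed.isCompact (fun k => (hcell b k).1.isClosed)
    exact ⟨x, splitCode_eq fun k => mem_iInter.1 hx k⟩
  exact ⟨Continuous.homeoOfEquivCompactToT2 (f := Equiv.ofBijective _ ⟨hinj, hsurj⟩) hcont⟩

theorem perfectSpace_cantor : PerfectSpace Cantor := by
  refine ⟨preperfect_iff_nhds.2 fun x _ V hV => ?_⟩
  obtain ⟨W, hWV, hW, hxW⟩ := mem_nhds_iff.1 hV
  obtain ⟨F, hF⟩ := exists_finset_agree isCompact_singleton hW (singleton_subset_iff.2 hxW)
  obtain ⟨n, hn⟩ := Infinite.exists_notMem_finset F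
  -- Flipping a coordinate outside `F` gives another point of the neighbourhood.
  refine ⟨Function.update x n (!x n), ⟨hWV (hF x rfl _ fun i hi => ?_), trivial⟩, fun h => ?_⟩
  · exact Function.update_of_ne (fun h : i = n => hn (h ▸ hi)) _ _
  · simpa using congrFun h n

theorem nonempty_homeomorph_clopen {V : Set Cantor} (hV : IsClopen V) (hne : V.Nonempty) :
    Nonempty (V ≃ₜ Cantor) := by
  have := perfectSpace_cantor
  have : CompactSpace V := isCompact_iff_compactSpace.1 hV.isClosed.isCompact
  have : Nonempty V := hne.to_subtype
  have : PerfectSpace V := by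
    refine ⟨preperfect_iff_nhds.2 fun x _ W hW => ?_⟩
    obtain ⟨y, ⟨hy, hyV⟩, hyx⟩ := preperfect_iff_nhds.1 hV.isOpen.preperfect x.1 x.2
      (Subtype.val '' W) (hV.isOpen.isOpenMap_subtype_val.image_mem_nhds hW)
    obtain ⟨z, hz, rfl⟩ := hy
    exact ⟨z, ⟨hz, trivial⟩, fun h => hyx (h ▸ rfl)⟩
  have hc : ∀ (n : ℕ) (b : Bool), IsClopen {x : V | x.1 n = b} := fun n b =>
    (isClopen_discrete {b}).preimage ((continuous_apply n).comp continuous_subtype_val)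
  refine nonempty_homeomorph_cantor (fun p : ℕ × Bool => {x : V | x.1 p.1 = p.2})
    (fun p => hc p.1 p.2) fun x y hxy => ?_
  obtain ⟨n, hn⟩ := Function.ne_iff.1 fun h => hxy (Subtype.ext h)
  exact ⟨(n, x.1 n), rfl, fun h : y.1 n = x.1 n => hn h.symm⟩

/-- Two labellings of the Cantor space with the same set of labels differ by a homeomorphism. -/
theorem exists_homeomorph_comp_eq {P : Type*} [TopologicalSpace P] [DiscreteTopology P]
    {a b : Cantor → P} (ha : Continuous a) (hb : Continuous b) (hab : range a = range b) :
    ∃ h : Cantor ≃ₜ Cantor, ∀ x, b (h x) = a x := by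
  have key : ∀ p, Nonempty ((a ⁻¹' {p} : Set Cantor) ≃ₜ (b ⁻¹' {p} : Set Cantor)) := by
    intro p
    by_cases hp : p ∈ range a
    · obtain ⟨e⟩ := nonempty_homeomorph_clopen ((isClopen_discrete {p}).preimage ha) hp
      obtain ⟨e'⟩ := nonempty_homeomorph_clopen ((isClopen_discrete {p}).preimage hb)
        (show p ∈ range b from hab ▸ hp)
      exact ⟨e.trans e'.symm⟩
    · have h1 : IsEmpty (a ⁻¹' {p} : Set Cantor) := ⟨fun x => hp ⟨x.1, x.2⟩⟩
      have h2 : IsEmpty (b ⁻¹' {p} : Set Cantor) := ⟨fun x => hp (hab ▸ ⟨x.1, x.2⟩)⟩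
      exact ⟨Homeomorph.empty⟩
  have e := fun p => (key p).some
  -- The homeomorphisms between corresponding clopen fibres are glued.
  let h : Cantor → Cantor := fun x => (e (a x) ⟨x, rfl⟩).1
  have hh : ∀ {p : P} (x : (a ⁻¹' {p} : Set Cantor)), h x.1 = (e p x).1 := by
    rintro p ⟨x, rfl⟩
    rfl
  have hba : ∀ x, b (h x) = a x := fun x => (e (a x) ⟨x, rfl⟩).2
  have hcont : Continuous h := by
    refine continuous_iff_continuousAt.2 fun x => ?_
    have ho : IsOpen (a ⁻¹' {a x}) := (isOpen_discrete _).preimage ha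
    have hon : ContinuousOn h (a ⁻¹' {a x}) := by
      rw [continuousOn_iff_continuous_domRestrict]
      have : (a ⁻¹' {a x}).domRestrict h = fun z => (e (a x) z).1 := funext fun z => hh z
      rw [this]
      exact continuous_subtype_val.comp (e (a x)).continuous
    exact hon.continuousAt (ho.mem_nhds rfl)
  have hinj : Function.Injective h := by
    intro x y hxy
    have hp : a y = a x := by rw [← hba, ← hba, hxy]
    have h1 := hh (p := a x) ⟨x, rfl⟩
    have h2 := hh (p := a x) ⟨y, hp⟩
    have h3 := (e (a x)).injective (Subtype.ext (h1.symm.trans (hxy.trans h2)))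
    exact congrArg Subtype.val h3
  have hsurj : Function.Surjective h := by
    intro z
    obtain ⟨x, hx⟩ := (e (b z)).surjective ⟨z, rfl⟩
    exact ⟨x.1, by rw [hh x, hx]⟩
  exact ⟨Continuous.homeoOfEquivCompactToT2 (f := Equiv.ofBijective h ⟨hinj, hsurj⟩) hcont, hba⟩

end Brouwer

/-! ### The profinite completion as a Cantor space -/

section

variable (G : Type u) [Group G]

/-- The profinite completion of `G`. -/
abbrev Completion : ProfiniteGrp.{u} := ProfiniteGrp.ProfiniteCompletion.completion (GrpCat.of G)

variable {G}

/-- The canonical homomorphism of `G` into its profinite completion. -/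
def toCompletion : G →* Completion G := (ProfiniteGrp.ProfiniteCompletion.eta (GrpCat.of G)).hom

/-- The projection of the profinite completion onto a finite quotient. -/
def completionProj (N : FiniteIndexNormalSubgroup G) (z : Completion G) : G ⧸ N.toSubgroup :=
  z.val N

theorem denseRange_toCompletion : DenseRange (toCompletion : G → Completion G) :=
  ProfiniteGrp.ProfiniteCompletion.denseRange (G := GrpCat.of G)

theorem profiniteTranslation_apply (g : G) (z : Completion G) :
    profiniteTranslation G g z = toCompletion g * z := rfl

theorem completionProj_mul (N : FiniteIndexNormalSubgroup G) (x y : Completion G) :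
    completionProj N (x * y) = completionProj N x * completionProj N y := rfl

theorem completionProj_toCompletion (N : FiniteIndexNormalSubgroup G) (g : G) :
    completionProj N (toCompletion g) = (g : G ⧸ N.toSubgroup) := rfl

theorem Completion.ext {x y : Completion G} (h : ∀ N, completionProj N x = completionProj N y) :
    x = y := Subtype.ext (funext h)

theorem isLocallyConstant_completionProj (N : FiniteIndexNormalSubgroup G) :
    IsLocallyConstant (completionProj N) := by
  let _ : TopologicalSpace (G ⧸ N.toSubgroup) := ⊥
  have : DiscreteTopology (G ⧸ N.toSubgroup) := ⟨rfl⟩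
  refine IsLocallyConstant.iff_continuous _ |>.2 ?_
  exact (continuous_apply N).comp continuous_subtype_val

theorem completionProj_of_le {N M : FiniteIndexNormalSubgroup G} (h : N ≤ M) (z : Completion G) :
    QuotientGroup.map N.toSubgroup M.toSubgroup (MonoidHom.id G) h (completionProj N z) =
      completionProj M z := z.2 (CategoryTheory.homOfLE h)

/-- A compatible family of elements of the finite quotients is an element of the completion. -/
def Completion.mk (x : ∀ N : FiniteIndexNormalSubgroup G, G ⧸ N.toSubgroup)
    (hx : ∀ N M (h : N ≤ M),
      QuotientGroup.map N.toSubgroup M.toSubgroup (MonoidHom.id G) h (x N) = x M) :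
    Completion G := ⟨x, fun {N M} f => hx N M f.le⟩

theorem continuous_to_completion {X : Type v} [TopologicalSpace X] {f : X → Completion G}
    (hf : ∀ N, IsLocallyConstant fun x => completionProj N (f x)) : Continuous f := by
  refine Continuous.subtype_mk (f := fun x => (f x).val) (continuous_pi fun N => ?_) _
  exact @IsLocallyConstant.continuous _ _ _ ⊥ _ (hf N)

theorem isClopen_setOf_locallyConstant_eq {X Y : Type*} [TopologicalSpace X] {f g : X → Y}
    (hf : IsLocallyConstant f) (hg : IsLocallyConstant g) : IsClopen {x | f x = g x} :=
  ⟨⟨(hf.prodMk hg) {q | q.1 ≠ q.2}⟩, (hf.prodMk hg) {q | q.1 = q.2}⟩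

theorem isClopen_setOf_fst_eq_snd {X Y : Type*} [TopologicalSpace X] {f : X → Y}
    (hf : IsLocallyConstant f) : IsClopen {p : X × X | f p.1 = f p.2} :=
  isClopen_setOf_locallyConstant_eq (hf.comp_continuous continuous_fst)
    (hf.comp_continuous continuous_snd)

/-- By compactness: otherwise the pairs not separated by `N` but separated by `c` form a directed
family of non-empty closed sets, and a common pair would be diagonal. -/
theorem exists_completionProj_refines {P : Type*} {c : Completion G → P}
    (hc : IsLocallyConstant c) : ∃ N : FiniteIndexNormalSubgroup G, ∀ x y,
      completionProj N x = completionProj N y → c x = c y := by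
  by_contra! h
  let D : FiniteIndexNormalSubgroup G → Set (Completion G × Completion G) := fun N =>
    {p | completionProj N p.1 = completionProj N p.2} ∩ {p | c p.1 ≠ c p.2}
  have hclosed : ∀ N, IsClosed (D N) := by
    intro N
    exact (isClopen_setOf_fst_eq_snd (isLocallyConstant_completionProj N)).isClosed.inter
      (isClopen_setOf_fst_eq_snd hc).compl.isClosed
  have : Nonempty (FiniteIndexNormalSubgroup G) := ⟨.ofSubgroup ⊤⟩
  have hne : (⋂ N, D N).Nonempty := by
    refine IsCompact.nonempty_iInter_of_directed_nonempty_isCompact_isClosed D ?_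
      (fun N => ?_) (fun N => (hclosed N).isCompact) hclosed
    · refine fun N M => ⟨N ⊓ M, fun p hp => ⟨?_, hp.2⟩, fun p hp => ⟨?_, hp.2⟩⟩
      · have h1 : completionProj (N ⊓ M) p.1 = completionProj (N ⊓ M) p.2 := hp.1
        change completionProj N p.1 = completionProj N p.2
        rw [← completionProj_of_le inf_le_left, h1, completionProj_of_le inf_le_left]
      · have h1 : completionProj (N ⊓ M) p.1 = completionProj (N ⊓ M) p.2 := hp.1
        change completionProj M p.1 = completionProj M p.2
        rw [← completionProj_of_le inf_le_right, h1, completionProj_of_le inf_le_right]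
    · obtain ⟨x, y, h1, h2⟩ := h N
      exact ⟨(x, y), h1, h2⟩
  obtain ⟨⟨x, y⟩, hp⟩ := hne
  have hxy : x = y := Completion.ext fun N => (mem_iInter.1 hp N).1
  exact (mem_iInter.1 hp (.ofSubgroup ⊤)).2 (congrArg c hxy)

/-- The kernel of a homomorphism to a finite group. -/
def kerFiniteIndex {H : Type*} [Group H] [Finite H] (ρ : G →* H) : FiniteIndexNormalSubgroup G :=
  .ofSubgroup ρ.ker

/-- The map from the profinite completion to a finite `G`-set that extends the orbit map. -/
def completionOrbitMap {Y : Type*} [Finite Y] (ρ : G →* Equiv.Perm Y) (y : Y)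
    (z : Completion G) : Y :=
  QuotientGroup.kerLift ρ (completionProj (kerFiniteIndex ρ) z) y

section

variable {Y : Type*} [Finite Y] (ρ : G →* Equiv.Perm Y) (y : Y)

theorem isLocallyConstant_completionOrbitMap : IsLocallyConstant (completionOrbitMap ρ y) :=
  (isLocallyConstant_completionProj (kerFiniteIndex ρ)).comp
    fun q => QuotientGroup.kerLift ρ q y

theorem completionOrbitMap_toCompletion (g : G) :
    completionOrbitMap ρ y (toCompletion g) = ρ g y := rfl

theorem completionOrbitMap_mul (g : G) (z : Completion G) :
    completionOrbitMap ρ y (toCompletion g * z) = ρ g (completionOrbitMap ρ y z) := by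
  simp only [completionOrbitMap, completionProj_mul]
  erw [map_mul]
  rfl

end

variable (G) in
/-- The intersection of the kernels of all actions of `G` on a set with `k` elements. -/
noncomputable def levelSubgroup [Group.FG G] (k : ℕ) : FiniteIndexNormalSubgroup G :=
  have := finite_monoidHom G (Equiv.Perm (Fin k))
  kerFiniteIndex (MonoidHom.pi fun f : G →* Equiv.Perm (Fin k) => f)

/-- The level subgroups are a countable cofinal family. The action of `G` on `G ⧸ N` is one of those
whose kernels are intersected, and an element fixing the trivial coset lies in `N`. -/
theorem exists_levelSubgroup_le [Group.FG G] (N : FiniteIndexNormalSubgroup G) :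
    ∃ k, levelSubgroup G k ≤ N := by
  let e := Finite.equivFin (G ⧸ N.toSubgroup)
  refine ⟨Nat.card (G ⧸ N.toSubgroup), fun (g : G) hg => ?_⟩
  have h1 := congrFun (show (fun f : G →* Equiv.Perm (Fin (Nat.card (G ⧸ N.toSubgroup))) => f g) = 1
    from hg) (e.permCongrHom.toMonoidHom.comp (MulAction.toPermHom G (G ⧸ N.toSubgroup)))
  have h2 := congrArg (fun σ => e.symm (σ (e ((1 : G) : G ⧸ N.toSubgroup)))) h1
  have h3 : g • ((1 : G) : G ⧸ N.toSubgroup) = ((1 : G) : G ⧸ N.toSubgroup) := by simpa using h2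
  rw [MulAction.Quotient.smul_coe, smul_eq_mul, mul_one] at h3
  exact (QuotientGroup.eq_one_iff g).1 h3

theorem completionProj_surjective (N : FiniteIndexNormalSubgroup G) :
    Function.Surjective (completionProj N) := fun q => by
  obtain ⟨g, rfl⟩ := QuotientGroup.mk_surjective q
  exact ⟨toCompletion g, rfl⟩

theorem infinite_completion (G : Type u) [Group G] [IsFreeGroup G] [Nontrivial G] :
    Infinite (Completion G) := by
  by_contra hfin
  rw [not_infinite_iff_finite] at hfin
  have hgen : Nonempty (IsFreeGroup.Generators G) := by
    by_contra h
    rw [not_nonempty_iff] at h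
    exact not_subsingleton G (IsFreeGroup.mulEquiv G).symm.toEquiv.subsingleton
  -- The completion surjects onto every finite cyclic group, including one larger than itself.
  let n := Nat.card (Completion G) + 1
  have : NeZero n := ⟨Nat.succ_ne_zero _⟩
  let f : G →* Multiplicative (ZMod n) := IsFreeGroup.lift fun _ => Multiplicative.ofAdd 1
  have hf : Function.Surjective f := fun q => by
    refine ⟨IsFreeGroup.of hgen.some ^ (Multiplicative.toAdd q).val, ?_⟩
    rw [map_pow, IsFreeGroup.lift_of, ← ofAdd_nsmul]
    simp
  have h1 : Nat.card (G ⧸ (kerFiniteIndex f).toSubgroup) = n := by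
    refine (Nat.card_congr (QuotientGroup.quotientKerEquivOfSurjective f hf).toEquiv).trans ?_
    simp
  have h2 := Nat.card_le_card_of_surjective _ (completionProj_surjective (kerFiniteIndex f))
  omega

/-- By homogeneity one isolated point would make this compact group discrete, hence finite. -/
theorem perfectSpace_completion (G : Type u) [Group G] [IsFreeGroup G] [Nontrivial G] :
    PerfectSpace (Completion G) := by
  refine perfectSpace_iff_forall_not_isolated.2 fun x => ?_
  by_contra h
  rw [Filter.not_neBot, ← isOpen_singleton_iff_punctured_nhds] at h
  have h1 : IsOpen ({1} : Set (Completion G)) := by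
    have := h.preimage (continuous_const_mul x)
    convert this using 1
    ext z
    simp
  have := discreteTopology_of_isOpen_singleton_one h1
  have := infinite_completion G
  have : Finite (Completion G) := finite_of_compact_of_discrete
  exact _root_.not_finite (Completion G)

theorem nonempty_completion_homeomorph_cantor (G : Type u) [Group G] [IsFreeGroup G] [Group.FG G]
    [Nontrivial G] : Nonempty (Completion G ≃ₜ Cantor) := by
  have := perfectSpace_completion G
  refine nonempty_homeomorph_cantor
    (fun i : Σ k, G ⧸ (levelSubgroup G k).toSubgroup =>
      completionProj (levelSubgroup G i.1) ⁻¹' {i.2})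
    (fun i => (isLocallyConstant_completionProj _).isClopen_fiber i.2) fun x y hxy => ?_
  obtain ⟨N, hN⟩ : ∃ N, completionProj N x ≠ completionProj N y := by
    by_contra! h
    exact hxy (Completion.ext h)
  obtain ⟨k, hk⟩ := exists_levelSubgroup_le N
  refine ⟨⟨k, completionProj _ x⟩, rfl, fun h => hN ?_⟩
  have h : completionProj (levelSubgroup G k) y = completionProj (levelSubgroup G k) x := h
  rw [← completionProj_of_le hk, ← h, completionProj_of_le hk]

theorem isMinimal_profiniteTranslation (G : Type u) [Group G] :
    IsMinimal (profiniteTranslation G) := by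
  classical
  rintro U hU ⟨u, hu⟩
  have hcov : (univ : Set (Completion G)) ⊆ ⋃ g : G, profiniteTranslation G g '' U := by
    intro z _
    have ho : IsOpen ((fun a : Completion G => a⁻¹ * z) ⁻¹' U) := hU.preimage (by fun_prop)
    obtain ⟨g, hg⟩ := denseRange_toCompletion.exists_mem_open ho ⟨z * u⁻¹, by simpa using hu⟩
    refine mem_iUnion.2 ⟨g, _, hg, ?_⟩
    rw [profiniteTranslation_apply, mul_inv_cancel_left]
  obtain ⟨F, hF⟩ := isCompact_univ.elim_finite_subcover _
    (fun g => (profiniteTranslation G g).isOpenMap U hU) hcov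
  exact ⟨F, eq_univ_of_univ_subset hF⟩

theorem hasInvariantMeasure_profiniteTranslation (G : Type u) [Group G] :
    HasInvariantMeasure (profiniteTranslation G) := by
  let _ : MeasurableSpace (Completion G) := borel _
  have : BorelSpace (Completion G) := ⟨rfl⟩
  let K : TopologicalSpace.PositiveCompacts (Completion G) := ⊤
  refine ⟨MeasureTheory.Measure.haarMeasure K, ⟨MeasureTheory.Measure.haarMeasure_self⟩,
    fun g a _ => ?_⟩
  have h : profiniteTranslation G g '' a = (fun z => toCompletion g⁻¹ * z) ⁻¹' a := by
    rw [map_inv]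
    exact image_mul_left
  rw [h, MeasureTheory.measure_preimage_mul]

end

/-! ### Genericity of the profinite translation -/

section

variable {G : Type u} [Group G] {Z : Type v} [TopologicalSpace Z] {W : Type w} [TopologicalSpace W]

theorem Isomorphic.isMinimal {φ : G →* (Z ≃ₜ Z)} {ψ : G →* (W ≃ₜ W)} (h : Isomorphic φ ψ)
    (hψ : IsMinimal ψ) : IsMinimal φ := by
  obtain ⟨f, hf⟩ := h
  intro U hU hne
  obtain ⟨F, hF⟩ := hψ (f '' U) (f.isOpenMap U hU) (hne.image f)
  refine ⟨F, eq_univ_of_forall fun z => ?_⟩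
  have hz : f z ∈ ⋃ g ∈ F, ψ g '' (f '' U) := hF ▸ mem_univ _
  simp only [mem_iUnion, exists_prop] at hz ⊢
  obtain ⟨g, hg, _, ⟨u, hu, rfl⟩, h⟩ := hz
  exact ⟨g, hg, u, hu, f.injective (by rw [hf, h])⟩

theorem Isomorphic.hasInvariantMeasure {φ : G →* (Z ≃ₜ Z)} {ψ : G →* (W ≃ₜ W)}
    (h : Isomorphic φ ψ) (hψ : HasInvariantMeasure ψ) : HasInvariantMeasure φ := by
  obtain ⟨f, hf⟩ := h
  let _ : MeasurableSpace Z := borel Z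
  have : BorelSpace Z := ⟨rfl⟩
  let _ : MeasurableSpace W := borel W
  have : BorelSpace W := ⟨rfl⟩
  obtain ⟨μ, hμ, hinv⟩ := hψ
  have hm : Measurable f.symm := f.symm.continuous.measurable
  refine ⟨μ.map f.symm, MeasureTheory.Measure.isProbabilityMeasure_map hm.aemeasurable,
    fun g a ha => ?_⟩
  have ha' : MeasurableSet (φ g '' a) := (φ g).toMeasurableEquiv.measurableSet_image.2 ha
  rw [MeasureTheory.Measure.map_apply hm ha', MeasureTheory.Measure.map_apply hm ha,
    ← hinv g _ (hm ha)]
  congr 1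
  rw [← f.image_eq_preimage_symm, ← f.image_eq_preimage_symm, image_image, image_image]
  exact image_congr fun x _ => hf g x

/-- The transport of an action along a homeomorphism. -/
def transport (e : Z ≃ₜ W) (φ : G →* (Z ≃ₜ Z)) : G →* (W ≃ₜ W) where
  toFun g := (e.symm.trans (φ g)).trans e
  map_one' := by ext x; simp
  map_mul' g h := by ext x; simp

theorem isomorphic_transport (e : Z ≃ₜ W) (φ : G →* (Z ≃ₜ Z)) : Isomorphic (transport e φ) φ :=
  ⟨e.symm, fun g z => by simp [transport]⟩

theorem mem_conjClass_transport_iff (e : Z ≃ₜ Cantor) (φ : G →* (Z ≃ₜ Z)) (η : ActionSpace G) :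
    η ∈ conjClass (transport e φ) ↔ Isomorphic η φ := by
  constructor
  · rintro ⟨f, hf⟩
    refine ⟨f.symm.trans e.symm, fun g z => ?_⟩
    change e.symm (f.symm (η g z)) = φ g (e.symm (f.symm z))
    rw [hf g]
    change e.symm (f.symm (f (e (φ g (e.symm (f.symm z)))))) = _
    simp
  · rintro ⟨f, hf⟩
    refine ⟨(f.trans e).symm, fun g => ?_⟩
    ext1 z
    change η g z = f.symm (e.symm (e (φ g (e.symm (e (f z))))))
    simp only [Homeomorph.symm_apply_apply, ← hf]

theorem IsMinimal.exists_mem {φ : G →* (Z ≃ₜ Z)} (hφ : IsMinimal φ) {U : Set Z} (hU : IsOpen U)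
    (hne : U.Nonempty) (z : Z) : ∃ g, φ g z ∈ U := by
  obtain ⟨F, hF⟩ := hφ U hU hne
  have hz : z ∈ ⋃ g ∈ F, φ g '' U := hF ▸ mem_univ _
  simp only [mem_iUnion, exists_prop] at hz
  obtain ⟨g, -, u, hu, rfl⟩ := hz
  refine ⟨g⁻¹, ?_⟩
  rw [← Homeomorph.mul_apply, ← map_mul]
  simpa using hu

/-- An equivariant locally constant map to the finite quotient `G ⧸ N`. -/
def IsQuotientFactor (φ : G →* (Z ≃ₜ Z)) (N : FiniteIndexNormalSubgroup G)
    (f : Z → G ⧸ N.toSubgroup) : Prop :=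
  IsLocallyConstant f ∧ ∀ g z, f (φ g z) = (g : G ⧸ N.toSubgroup) * f z

theorem IsQuotientFactor.mul_right {φ : G →* (Z ≃ₜ Z)} {N : FiniteIndexNormalSubgroup G}
    {f : Z → G ⧸ N.toSubgroup} (hf : IsQuotientFactor φ N f) (q : G ⧸ N.toSubgroup) :
    IsQuotientFactor φ N fun z => f z * q :=
  ⟨hf.1.comp (· * q), fun g z => by simp only [hf.2, mul_assoc]⟩

theorem IsQuotientFactor.map {φ : G →* (Z ≃ₜ Z)} {N M : FiniteIndexNormalSubgroup G}
    {f : Z → G ⧸ N.toSubgroup} (hf : IsQuotientFactor φ N f) (h : N ≤ M) :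
    IsQuotientFactor φ M fun z =>
      QuotientGroup.map N.toSubgroup M.toSubgroup (MonoidHom.id G) h (f z) :=
  ⟨hf.1.comp _, fun g z => by simp only [hf.2, map_mul]; rfl⟩

/-- The points where the factors differ form an open set, which would meet the orbit of `z₀`,
whereas agreement at `z₀` spreads along its orbit. -/
theorem IsQuotientFactor.eq {φ : G →* (Z ≃ₜ Z)} (hφ : IsMinimal φ)
    {N : FiniteIndexNormalSubgroup G} {f f' : Z → G ⧸ N.toSubgroup} (hf : IsQuotientFactor φ N f)
    (hf' : IsQuotientFactor φ N f') {z₀ : Z} (h₀ : f z₀ = f' z₀) : f = f' := by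
  by_contra hne
  obtain ⟨z, hz⟩ := Function.ne_iff.1 hne
  obtain ⟨g, hg⟩ := hφ.exists_mem
    (isClopen_setOf_locallyConstant_eq hf.1 hf'.1).compl.isOpen ⟨z, hz⟩ z₀
  exact hg (show f _ = f' _ by rw [hf.2, hf'.2, h₀])

/-- A minimal action on a compact space that has all the finite quotients of `G` as factors, and
whose points are separated by such factors, is the translation on the profinite completion. -/
theorem isomorphic_profiniteTranslation [CompactSpace Z] [Nonempty Z] {φ : G →* (Z ≃ₜ Z)}
    (hφ : IsMinimal φ) (hex : ∀ N, ∃ f, IsQuotientFactor φ N f)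
    (hsep : ∀ x y, x ≠ y → ∃ N f, IsQuotientFactor φ N f ∧ f x ≠ f y) :
    Isomorphic φ (profiniteTranslation G) := by
  obtain ⟨z₀⟩ := ‹Nonempty Z›
  -- Normalised at `z₀`, the factors are unique and hence compatible, so they assemble to a map into
  -- the completion.
  have hex' : ∀ N, ∃ f, IsQuotientFactor φ N f ∧ f z₀ = 1 := fun N => by
    obtain ⟨f, hf⟩ := hex N
    exact ⟨_, hf.mul_right (f z₀)⁻¹, mul_inv_cancel _⟩
  choose f hf hf₀ using hex'
  let F : Z → Completion G := fun z => Completion.mk (fun N => f N z) fun N M h =>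
    congrFun (((hf N).map h).eq hφ (hf M) (z₀ := z₀) (by rw [hf₀, hf₀, map_one])) z
  have hF : ∀ N z, completionProj N (F z) = f N z := fun _ _ => rfl
  have hcont : Continuous F := continuous_to_completion fun N => (hf N).1
  have heq : ∀ g z, F (φ g z) = toCompletion g * F z := fun g z => Completion.ext fun N => by
    rw [completionProj_mul, hF, hF, (hf N).2, completionProj_toCompletion]
  have hF₀ : F z₀ = 1 := Completion.ext fun N => hf₀ N
  have hsurj : Function.Surjective F := by
    rw [← range_eq_univ, ← (isCompact_range hcont).isClosed.closure_eq]
    refine (denseRange_toCompletion.mono ?_).closure_eq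
    rintro _ ⟨g, rfl⟩
    exact ⟨φ g z₀, by rw [heq, hF₀, mul_one]⟩
  have hinj : Function.Injective F := by
    intro x y hxy
    by_contra hne
    obtain ⟨N, f', hf', h⟩ := hsep x y hne
    have h1 : (fun z => f N z * f' z₀) = f' :=
      ((hf N).mul_right _).eq hφ hf' (z₀ := z₀) (by rw [hf₀, one_mul])
    refine h ?_
    rw [← h1]
    simp only [← hF, hxy]
  exact ⟨Continuous.homeoOfEquivCompactToT2 (f := Equiv.ofBijective F ⟨hinj, hsurj⟩) hcont, heq⟩

theorem continuous_eval_action (g : G) :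
    Continuous fun ξ : ActionSpace G => (ξ g : C(Cantor, Cantor)) :=
  (continuous_apply (A := fun _ : G => C(Cantor, Cantor)) g).comp
    (continuous_induced_dom (f := fun (ξ : ActionSpace G) (g : G) => (ξ g : C(Cantor, Cantor))))

/-- Equivariance need only hold for finitely many generators and on finitely many clopen fibres, and
each such condition sends a compact set into an open one. -/
theorem isOpen_setOf_isQuotientFactor [Group.FG G] {N : FiniteIndexNormalSubgroup G}
    {f : Cantor → G ⧸ N.toSubgroup} : IsOpen {ξ : ActionSpace G | IsQuotientFactor ξ N f} := by
  by_cases hf : IsLocallyConstant f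
  swap
  · convert isOpen_empty
    exact eq_empty_of_forall_notMem fun ξ h => hf h.1
  obtain ⟨S, hS, hfin⟩ := (Group.fg_iff (G := G)).1 inferInstance
  have : {ξ : ActionSpace G | IsQuotientFactor ξ N f} = ⋂ s ∈ S, ⋂ q : G ⧸ N.toSubgroup,
      {ξ | MapsTo (ξ s : C(Cantor, Cantor)) (f ⁻¹' {q})
        (f ⁻¹' {(s : G ⧸ N.toSubgroup) * q})} := by
    ext ξ
    simp only [mem_iInter]
    constructor
    · rintro h s - q x rfl
      exact h.2 s x
    · intro h
      refine ⟨hf, fun g => ?_⟩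
      have hg : g ∈ Subgroup.closure S := hS ▸ Subgroup.mem_top g
      induction hg using Subgroup.closure_induction with
      | mem s hs => exact fun z => h s hs (f z) rfl
      | one => intro z; simp
      | mul a b _ _ iha ihb =>
        intro z
        rw [map_mul, Homeomorph.mul_apply, iha, ihb, QuotientGroup.mk_mul, mul_assoc]
      | inv a _ ih =>
        intro z
        have h1 := ih (ξ a⁻¹ z)
        rw [← Homeomorph.mul_apply, ← map_mul, mul_inv_cancel, map_one, Homeomorph.one_apply] at h1
        rw [h1, QuotientGroup.mk_inv, inv_mul_cancel_left]
  rw [this]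
  refine hfin.isOpen_biInter fun s _ => isOpen_iInter_of_finite fun q => ?_
  exact (ContinuousMap.isOpen_setOfPred_mapsTo (hf.isClosed_fiber q).isCompact
    (hf.isOpen_fiber _)).preimage (continuous_eval_action s)

theorem tendsto_action_of_agree {ξ : ActionSpace G}
    {η : Finset G × Finset ℕ → ActionSpace G}
    (hη : ∀ p x, ∀ g ∈ p.1, ∀ i ∈ p.2, η p g x i = ξ g x i) :
    Tendsto η atTop (𝓝 ξ) := by
  classical
  have hind : IsInducing (fun (ξ : ActionSpace G) (g : G) => (ξ g : C(Cantor, Cantor))) := ⟨rfl⟩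
  rw [hind.tendsto_nhds_iff, tendsto_pi_nhds]
  refine fun g => ContinuousMap.tendsto_nhds_compactOpen.2 fun K hK U hU hKU => ?_
  obtain ⟨F, hF⟩ := exists_finset_agree (hK.image (ξ g).continuous) hU (image_subset_iff.2 hKU)
  filter_upwards [eventually_ge_atTop (({g} : Finset G), F)] with p hp x hx
  exact hF _ ⟨x, hx, rfl⟩ _ fun i hi => hη p x g (hp.1 (Finset.mem_singleton_self g)) i (hp.2 hi)

/-- A minimal action with an invariant measure is approximated by copies of the translation on the
profinite completion. -/
theorem exists_isomorphic_agree [IsFreeGroup G] [Group.FG G] (e : Completion G ≃ₜ Cantor)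
    {ξ : ActionSpace G} (hξ : ξ ∈ minPmpActions G) (F : Finset G) (E : Finset ℕ) :
    ∃ η : ActionSpace G, Isomorphic η (profiniteTranslation G) ∧
      ∀ x, ∀ g ∈ F, ∀ i ∈ E, η g x i = ξ g x i := by
  classical
  -- The pattern entry at `1` reads the coordinates of a point, the entries at `F` those of its
  -- images.
  obtain ⟨Y, hY, ρ, l, y₀, h1, h2⟩ := exists_finite_model_of_isMinimal hξ.1 hξ.2
    (c := fun (x : Cantor) (i : E) => x i) (by fun_prop) (insert 1 F)
  let I : Finset G := insert 1 F
  let a : Cantor → I → E → Bool := fun x g => l (ρ g (completionOrbitMap ρ y₀ (e.symm x)))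
  let b : Cantor → I → E → Bool := fun x g i => ξ g x i
  have ha : Continuous a :=
    (((isLocallyConstant_completionOrbitMap ρ y₀).comp fun y (g : I) => l (ρ g y)).comp_continuous
      e.symm.continuous).continuous
  have hb : Continuous b := continuous_pi fun g => continuous_pi fun i =>
    (continuous_apply (i : ℕ)).comp (ξ g).continuous
  -- One inclusion holds because the patterns of the model occur in `ξ`, the other because the orbit
  -- of `y₀` shows them all. Matching the labellings then carries the translation to an
  -- approximation of `ξ`.
  have hab : range a = range b := by
    refine Subset.antisymm ?_ ?_
    · rintro _ ⟨x, rfl⟩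
      obtain ⟨z, hz⟩ := h1 (completionOrbitMap ρ y₀ (e.symm x))
      exact ⟨z, funext fun g => (hz g g.2).symm⟩
    · rintro _ ⟨x, rfl⟩
      obtain ⟨h, hh⟩ := h2 x
      refine ⟨e (toCompletion h), funext fun g => ?_⟩
      simp only [a, Homeomorph.symm_apply_apply, completionOrbitMap_toCompletion]
      exact hh g g.2
  obtain ⟨h, hh⟩ := exists_homeomorph_comp_eq ha hb hab
  refine ⟨transport (e.trans h) (profiniteTranslation G), isomorphic_transport _ _,
    fun x g hg i hi => ?_⟩
  obtain ⟨z, rfl⟩ := (e.trans h).surjective x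
  have h3 : ∀ (z : Completion G) (k : G) (hk : k ∈ I) (i : ℕ) (hi : i ∈ E),
      ξ k ((e.trans h) z) i = l (ρ k (completionOrbitMap ρ y₀ z)) ⟨i, hi⟩ := by
    intro z k hk i hi
    have := congrFun (congrFun (hh (e z)) ⟨k, hk⟩) ⟨i, hi⟩
    simpa [a, b] using this
  have h4 : transport (e.trans h) (profiniteTranslation G) g ((e.trans h) z) =
      (e.trans h) (toCompletion g * z) := by
    simp [transport, profiniteTranslation_apply]
  have h5 := h3 (toCompletion g * z) 1 (Finset.mem_insert_self _ _) i hi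
  rw [map_one, Homeomorph.one_apply] at h5
  rw [h4, h5, h3 z g (Finset.mem_insert_of_mem hg) i hi, completionOrbitMap_mul, map_one,
    Equiv.Perm.one_apply]

theorem exists_comeager_conjClass (G : Type u) [Group G] [IsFreeGroup G] [Group.FG G]
    [Nontrivial G] : ∃ ξ₀ : ActionSpace G,
      conjClass ξ₀ ⊆ minPmpActions G ∧
      {ξ : minPmpActions G | (ξ : ActionSpace G) ∈ conjClass ξ₀} ∈ residual (minPmpActions G) ∧
      ∀ ξ ∈ conjClass ξ₀, Isomorphic ξ (profiniteTranslation G) := by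
  classical
  obtain ⟨e⟩ := nonempty_completion_homeomorph_cantor G
  have hmp : ∀ {η : ActionSpace G}, Isomorphic η (profiniteTranslation G) →
      η ∈ minPmpActions G := fun h =>
    ⟨h.isMinimal (isMinimal_profiniteTranslation G),
      h.hasInvariantMeasure (hasInvariantMeasure_profiniteTranslation G)⟩
  refine ⟨transport e (profiniteTranslation G),
    fun η hη => hmp ((mem_conjClass_transport_iff _ _ _).1 hη), ?_,
    fun η hη => (mem_conjClass_transport_iff _ _ _).1 hη⟩
  simp only [mem_conjClass_transport_iff]
  let C : Set (minPmpActions G) := {ξ | Isomorphic ξ.1 (profiniteTranslation G)}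
  have hdense : Dense C := by
    intro ξ
    choose η hη hηξ using fun p : Finset G × Finset ℕ => exists_isomorphic_agree e ξ.2 p.1 p.2
    let η' : Finset G × Finset ℕ → minPmpActions G := fun p => ⟨η p, hmp (hη p)⟩
    have hlim : Tendsto η' atTop (𝓝 ξ) := tendsto_subtype_rng.2 (tendsto_action_of_agree hηξ)
    exact mem_closure_of_tendsto hlim (Eventually.of_forall hη)
  have hfac : ∀ {η : ActionSpace G}, Isomorphic η (profiniteTranslation G) →
      ∃ k : Cantor ≃ₜ Completion G, ∀ N,
        IsQuotientFactor η N fun x => completionProj N (k x) := by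
    rintro η ⟨k, hk⟩
    refine ⟨k, fun N => ⟨(isLocallyConstant_completionProj N).comp_continuous k.continuous,
      fun g z => ?_⟩⟩
    simp only [hk, profiniteTranslation_apply, completionProj_mul, completionProj_toCompletion]
  -- The first condition asks for the quotient of level `k` as a factor; the second asks for a
  -- finite quotient factor that determines coordinate `k`, so that together these factors separate
  -- points.
  let O : ℕ → Set (ActionSpace G) := fun k =>
    (⋃ f, {ξ | IsQuotientFactor ξ (levelSubgroup G k) f}) ∩
    ⋃ N, ⋃ f, ⋃ _ : ∀ x y : Cantor, f x = f y → x k = y k, {ξ | IsQuotientFactor ξ N f}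
  have hO : ∀ k, IsOpen (O k) := fun k =>
    (isOpen_iUnion fun _ => isOpen_setOf_isQuotientFactor).inter
      (isOpen_iUnion fun _ => isOpen_iUnion fun _ => isOpen_iUnion fun _ =>
        isOpen_setOf_isQuotientFactor)
  have hCO : ∀ k, C ⊆ Subtype.val ⁻¹' O k := by
    intro k ξ hξ
    obtain ⟨h, hh⟩ := hfac hξ
    refine ⟨mem_iUnion.2 ⟨_, hh _⟩, ?_⟩
    have hc : IsLocallyConstant fun z : Completion G => h.symm z k :=
      (IsLocallyConstant.iff_continuous _).2 ((continuous_apply k).comp h.symm.continuous)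
    obtain ⟨N, hN⟩ := exists_completionProj_refines hc
    simp only [mem_iUnion]
    exact ⟨N, _, fun x y hxy => by simpa using hN _ _ hxy, hh N⟩
  have hres : (⋂ k, Subtype.val ⁻¹' O k : Set (minPmpActions G)) ∈ residual (minPmpActions G) :=
    countable_iInter_mem.2 fun k =>
      residual_of_dense_open ((hO k).preimage continuous_subtype_val) (hdense.mono (hCO k))
  refine mem_of_superset hres fun ξ hξ => ?_
  have hξ : ∀ k, ξ.1 ∈ O k := fun k => mem_iInter.1 hξ k
  refine isomorphic_profiniteTranslation ξ.2.1 (fun N => ?_) fun x y hxy => ?_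
  · obtain ⟨k, hk⟩ := exists_levelSubgroup_le N
    obtain ⟨f, hf⟩ := mem_iUnion.1 (hξ k).1
    exact ⟨_, IsQuotientFactor.map hf hk⟩
  · obtain ⟨k, hk⟩ := Function.ne_iff.1 hxy
    have h := (hξ k).2
    simp only [mem_iUnion] at h
    obtain ⟨N, f, hsep, hf⟩ := h
    exact ⟨N, f, hf, fun h => hk (hsep x y h)⟩

end

end CantorFlow

theorem theorem6p5 (G : Type u) [Group G] [IsFreeGroup G] [Group.FG G] :
    (Nontrivial G → ∃ ξ₀ : ActionSpace G,
      conjClass ξ₀ ⊆ minPmpActions G ∧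
      {ξ : minPmpActions G | (ξ : ActionSpace G) ∈ conjClass ξ₀} ∈ residual (minPmpActions G) ∧
      ∀ ξ ∈ conjClass ξ₀, Isomorphic ξ (profiniteTranslation G)) ∧
    (∀ (A : Type v) [Finite A] [TopologicalSpace A] [DiscreteTopology A],
      periodicTransitiveSubshifts G A ⊆ minPmpSubshifts G A ∧
      minPmpSubshifts G A ⊆ closure (periodicTransitiveSubshifts G A)) := by
  refine ⟨fun _ => exists_comeager_conjClass G, fun A _ _ _ => ?_⟩
  exact ⟨periodicTransitiveSubshifts_subset G A, minPmpSubshifts_subset_closure G A⟩
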